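/- Let $n\ge 1$ be an integer, let $\rho>1$ be real, and let $e_0,\dots,e_n$ be the canonical basis of $\mathbb{C}^{n+1}$. For a complex Hilbert space $H$, let $C_\rho(H)$ be the set of all bounded operators $T$ on $H$ for which there are a Hilbert space $\mathcal{H}$ containing $H$ as a closed subspace and a unitary operator $U$ on $\mathcal{H}$ with $T^k=\rho P_H U^k|_H$ for all $k\ge 1$, where $P_H$ is the orthogonal projection of $\mathcal{H}$ onto $H$. Put $w_\rho(T)=\inf\{\gamma>0 : \tfrac1\gamma T\in C_\rho(H)\}$. Say that $T_1$ is Harnack dominated by $T_0$ if there is a constant $c\ge 1$ such that $$\operatorname{Re} p(T_1)\le c^2\operatorname{Re} p(T_0)+(c^2-1)(\rho-1)\operatorname{Re} p(0_H)$$ for every complex polynomial $p$ with $\operatorname{Re} p\ge 0$ on the closed unit disc, and that $T_1$ and $T_0$ are Harnack equivalent if each is Harnack dominated by the other. For $b\in\mathbb{C}$ let $S_{n+1}(b)$ be the operator on $\mathbb{C}^{n+1}$ with $S_{n+1}(b)e_0=0$ and $S_{n+1}(b)e_k=b\,e_{k-1}$ for $1\le k\le n$. Let $S=S_{n+1}(a)$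 with $a=w_\rho(S_{n+1}(1))^{-1}$. If $T\in C_\rho(\mathbb{C}^{n+1})$ is Harnack equivalent to $S$, then $Te_0=0$ and $T^*e_n=0$. If moreover $n\ge 2$, then $\langle Te_n, e_0\rangle=0$. -/

import Mathlib

open scoped ComplexStarModule

noncomputable section

/-- `T` is a `ρ`-contraction: there are a Hilbert space `K`, an isometric embedding `J` of `H`
into `K` (so that `H` is a closed subspace of `K` and `J†` is the orthogonal projection onto it)
and a unitary operator `U` on `K` such that `T ^ k = ρ P_H U ^ k |_H` for every `k ≥ 1`. -/
def IsRhoContraction.{u} {H : Type u} [NormedAddCommGroup H] [InnerProductSpace ℂ H]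
    [CompleteSpace H] (ρ : ℝ) (T : H →L[ℂ] H) : Prop :=
  ∃ (K : Type u) (_ : NormedAddCommGroup K) (_ : InnerProductSpace ℂ K) (_ : CompleteSpace K)
    (J : H →ₗᵢ[ℂ] K) (U : K →L[ℂ] K),
    U ∈ unitary (K →L[ℂ] K) ∧
      ∀ k : ℕ, 1 ≤ k →
        T ^ k = (ρ : ℂ) •
          (ContinuousLinearMap.adjoint J.toContinuousLinearMap ∘L (U ^ k) ∘L
            J.toContinuousLinearMap)

/-- The class `C_ρ(H)` of all `ρ`-contractions on `H`. -/
def rhoClass.{u} (ρ : ℝ) (H : Type u) [NormedAddCommGroup H] [InnerProductSpace ℂ H]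
    [CompleteSpace H] : Set (H →L[ℂ] H) :=
  {T | IsRhoContraction ρ T}

/-- The `ρ`-numerical radius `w_ρ(T) = inf {γ > 0 : (1/γ) T ∈ C_ρ(H)}`. -/
def rhoRadius.{u} {H : Type u} [NormedAddCommGroup H] [InnerProductSpace ℂ H]
    [CompleteSpace H] (ρ : ℝ) (T : H →L[ℂ] H) : ℝ :=
  sInf {γ : ℝ | 0 < γ ∧ ((1 / γ : ℝ) : ℂ) • T ∈ rhoClass ρ H}

/-- `T₁` is Harnack dominated by `T₀` (for the parameter `ρ`): for some `c ≥ 1`,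
`Re p(T₁) ≤ c² Re p(T₀) + (c² - 1)(ρ - 1) Re p(0)` for every polynomial `p` with `Re p ≥ 0` on the
closed unit disc. Here `ℜ A = (A + A†)/2` and `≤` is the order of self-adjoint operators. -/
def HarnackDominated.{u} {H : Type u} [NormedAddCommGroup H] [InnerProductSpace ℂ H]
    [CompleteSpace H] (ρ : ℝ) (T₁ T₀ : H →L[ℂ] H) : Prop :=
  ∃ c : ℝ, 1 ≤ c ∧
    ∀ p : Polynomial ℂ, (∀ z : ℂ, ‖z‖ ≤ 1 → 0 ≤ (p.eval z).re) →
      (ℜ (Polynomial.aeval T₁ p) : H →L[ℂ] H) ≤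
        c ^ 2 • (ℜ (Polynomial.aeval T₀ p) : H →L[ℂ] H) +
          ((c ^ 2 - 1) * (ρ - 1)) • (ℜ (Polynomial.aeval (0 : H →L[ℂ] H) p) : H →L[ℂ] H)

/-- Harnack equivalence: each operator is Harnack dominated by the other. -/
def HarnackEquivalent.{u} {H : Type u} [NormedAddCommGroup H] [InnerProductSpace ℂ H]
    [CompleteSpace H] (ρ : ℝ) (T₁ T₀ : H →L[ℂ] H) : Prop :=
  HarnackDominated ρ T₁ T₀ ∧ HarnackDominated ρ T₀ T₁

/-- The operator `S_m(b)` on `ℂ^m` whose matrix in the canonical basis has `b` at the positions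
`(i, i + 1)` and `0` elsewhere. -/
def truncatedShift (m : ℕ) (b : ℂ) :
    EuclideanSpace ℂ (Fin m) →L[ℂ] EuclideanSpace ℂ (Fin m) :=
  Matrix.toEuclideanCLM (n := Fin m) (𝕜 := ℂ)
    (Matrix.of fun i j : Fin m => if (j : ℕ) = (i : ℕ) + 1 then b else 0)

/-- The `w_ρ`-normalized truncated shift `S = S_m(a)` of size `m`, with `a = w_ρ(S_m(1))⁻¹`. -/
def normalizedShift (ρ : ℝ) (m : ℕ) :
    EuclideanSpace ℂ (Fin m) →L[ℂ] EuclideanSpace ℂ (Fin m) :=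
  truncatedShift m (((rhoRadius ρ (truncatedShift m 1))⁻¹ : ℝ) : ℂ)

end

/-! Write `A_0 = ρ`, `A_j = T ^ j` and `A_{-j} = (T*) ^ j` for `j ≥ 1`. The Fejér sums `∑_{|j|<N} (N
- |j|) z ^ j A_j`, `|z| = 1`, are positive for every `ρ`-contraction, by compression of the Fejér
identity for the dilating unitary. Testing domination of `T` by `S` on Fejér polynomials bounds the
sum for `T` by `c ^ 2` times the sum for `S`.

Since `S` is nilpotent, its Fejér sum is `N K_z` minus a term independent of `N`, where `K_z` is
`rhoKernel ρ n (z • S)`. On a null vector `x` of `K_z` the quadratic form of the sum for `T` stays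
bounded in `N`, while its norm is `O(N)`; Cauchy–Schwarz makes its value at `x` only `O(√N)`.

At the critical weight `K_1` has a null vector `v ≠ 0`: were it invertible, the weight could be
increased. Diagonal unitaries carry `v` to the null vectors `∑ z ^ (-k) v_k e_k` of `K_z`. Comparing
Laurent coefficients in `z` as `N → ∞` gives `∑_k A_{m+k} v_k e_k = 0` for every integer `m`
(`HarnackDominated.sum_symbolCoeff_eq_zero`).

A recursion shows `v_0 ≠ 0` and `v_n ≠ 0`. Subtracting `T` times the relation `m = 0` from the
relation `m = 1` leaves `(1 - ρ) v_0 T e_0 = 0`; `m = -n` and `m = -n - 1` give `T* e_n = 0`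
likewise. Pairing `m = -n + 1` with `e_0` gives the last claim. -/

noncomputable section

/-! ### Cesàro sums and Fejér polynomials -/

/-- The Cesàro sum `∑ j < N, (N - j) x ^ j`. -/
def cesaroSum {A : Type*} [Ring A] [Algebra ℂ A] (N : ℕ) (x : A) : A :=
  ∑ j ∈ Finset.range N, ((N : ℂ) - j) • x ^ j

lemma cesaroSum_succ {A : Type*} [Ring A] [Algebra ℂ A] (N : ℕ) (x : A) :
    cesaroSum (N + 1) x = cesaroSum N x + ∑ j ∈ Finset.range (N + 1), x ^ j := by
  unfold cesaroSum
  rw [Finset.sum_range_succ, Finset.sum_range_succ (f := fun j => x ^ j), ← add_assoc,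
    ← Finset.sum_add_distrib]
  congr 1
  · refine Finset.sum_congr rfl fun j _ => ?_
    push_cast
    module
  · push_cast
    module

lemma cesaroSum_zero_right {A : Type*} [Ring A] [Algebra ℂ A] (N : ℕ) :
    cesaroSum N (0 : A) = (N : ℂ) • 1 := by
  unfold cesaroSum
  rcases N with _ | N
  · simp
  · rw [Finset.sum_range_succ']
    simp

/-- The Fejér identity for unitary elements. -/
lemma geom_mul_star_geom {A : Type*} [Ring A] [StarRing A] [Algebra ℂ A]
    {u : A} (hu : u ∈ unitary A) (N : ℕ) :
    (∑ i ∈ Finset.range N, u ^ i) * star (∑ i ∈ Finset.range N, u ^ i) =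
      cesaroSum N u + star (cesaroSum N u) - (N : ℂ) • 1 := by
  -- Since `u` is unitary, `u ^ N` reverses the adjoint geometric sum into `u + ⋯ + u ^ N`.
  have key : ∀ N : ℕ, u ^ N * star (∑ i ∈ Finset.range N, u ^ i) =
      (∑ j ∈ Finset.range (N + 1), u ^ j) - 1 := by
    intro N
    rw [Finset.sum_range_succ', pow_zero, add_sub_cancel_right, star_sum, Finset.mul_sum]
    rw [← Finset.sum_range_reflect]
    refine Finset.sum_congr rfl fun j hj => ?_
    have hj' := Finset.mem_range.1 hj
    have h1 : u ^ N = u ^ (j + 1) * u ^ (N - 1 - j) := by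
      rw [← pow_add]; congr 1; omega
    have h2 : u ^ (N - 1 - j) * star (u ^ (N - 1 - j)) = 1 :=
      Unitary.mul_star_self_of_mem (pow_mem hu _)
    rw [h1, mul_assoc, h2, mul_one]
  induction N with
  | zero => simp [cesaroSum]
  | succ N ih =>
    rw [Finset.sum_range_succ, star_add, add_mul, mul_add, mul_add, ih, key,
      Unitary.mul_star_self_of_mem (pow_mem hu _)]
    have h := congrArg star (key N)
    rw [star_mul, star_star, star_sub, star_one] at h
    rw [h, cesaroSum_succ, star_add]
    push_cast
    module

/-- The real part `2 Re (∑ j < N, (N - j) T ^ j) + (ρ - 2) N` of the Cesàro sum. -/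
def toeplitzSum {A : Type*} [Ring A] [StarRing A] [Algebra ℂ A] (ρ : ℝ) (N : ℕ) (T : A) : A :=
  cesaroSum N T + star (cesaroSum N T) + (((ρ : ℂ) - 2) * N) • 1

/-- On the unit circle the real part is `|∑ w ^ i| ^ 2` by the Fejér identity. The maximum principle
for `exp (-q)` carries the sign into the disc. -/
lemma two_mul_re_cesaroSum_sub_nonneg (N : ℕ) {w : ℂ} (hw : ‖w‖ ≤ 1) :
    0 ≤ (2 * cesaroSum N w - N).re := by
  set q : ℂ → ℂ := fun w => 2 * cesaroSum N w - N with hq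
  have hcont : Differentiable ℂ q := by
    unfold q cesaroSum
    fun_prop
  have hcirc : ∀ z : ℂ, ‖z‖ = 1 → 0 ≤ (q z).re := by
    intro z hz
    have hu : z ∈ unitary ℂ := by
      rw [Unitary.mem_iff]
      have h : star z * z = 1 := by
        rw [Complex.star_def, Complex.conj_mul', hz]; simp
      exact ⟨h, by rw [mul_comm]; exact h⟩
    have h := congrArg Complex.re (geom_mul_star_geom hu N)
    rw [Complex.star_def, Complex.mul_conj, Complex.ofReal_re] at h
    have h0 := Complex.normSq_nonneg (∑ i ∈ Finset.range N, z ^ i)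
    rw [h] at h0
    simp only [hq]
    simp at h0 ⊢
    linarith
  have hd : DiffContOnCl ℂ (fun w => Complex.exp (-q w)) (Metric.ball 0 1) :=
    (hcont.neg.cexp).diffContOnCl
  have := Complex.norm_le_of_forall_mem_frontier_norm_le (Metric.isBounded_ball) hd (C := 1)
    (z := w) (fun z hz => by
      rw [frontier_ball _ one_ne_zero, mem_sphere_zero_iff_norm] at hz
      rw [Complex.norm_exp, Real.exp_le_one_iff]
      have := hcirc z hz
      simpa using this) (by
      rw [closure_ball _ one_ne_zero]
      simpa using hw)
  rw [Complex.norm_exp, Real.exp_le_one_iff, Complex.neg_re, neg_nonpos] at this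
  exact this

/-- The polynomial `2 ∑ j < N, (N - j) z ^ j X ^ j - N`, a multiple of a Fejér kernel. -/
def fejerPoly (N : ℕ) (z : ℂ) : Polynomial ℂ :=
  (2 : ℂ) • cesaroSum N (z • (Polynomial.X : Polynomial ℂ)) - (N : ℂ) • 1

lemma map_cesaroSum {A B : Type*} [Ring A] [Algebra ℂ A] [Ring B] [Algebra ℂ B] (f : A →ₐ[ℂ] B)
    (N : ℕ) (x : A) : f (cesaroSum N x) = cesaroSum N (f x) := by
  simp [cesaroSum, map_sum]

lemma aeval_fejerPoly {A : Type*} [Ring A] [Algebra ℂ A] (N : ℕ) (z : ℂ) (T : A) :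
    Polynomial.aeval T (fejerPoly N z) = (2 : ℂ) • cesaroSum N (z • T) - (N : ℂ) • 1 := by
  rw [fejerPoly, map_sub, map_smul, map_smul, map_cesaroSum, map_smul, Polynomial.aeval_X,
    map_one]

lemma fejerPoly_eval_re_nonneg (N : ℕ) {z w : ℂ} (hz : ‖z‖ = 1) (hw : ‖w‖ ≤ 1) :
    0 ≤ ((fejerPoly N z).eval w).re := by
  have h := aeval_fejerPoly N z w
  rw [Polynomial.coe_aeval_eq_eval] at h
  rw [h]
  simpa using two_mul_re_cesaroSum_sub_nonneg N (w := z * w) (by rw [norm_mul, hz, one_mul]; exact hw)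

/-! ### Fejér sums of `ρ`-contractions under Harnack domination -/

section Hilbert

universe u
variable {H : Type u} [NormedAddCommGroup H] [InnerProductSpace ℂ H] [CompleteSpace H]

lemma realPart_aeval_fejerPoly (N : ℕ) (z : ℂ) (T : H →L[ℂ] H) :
    (ℜ (Polynomial.aeval T (fejerPoly N z)) : H →L[ℂ] H) =
      cesaroSum N (z • T) + star (cesaroSum N (z • T)) - (N : ℂ) • 1 := by
  rw [aeval_fejerPoly, realPart_apply_coe, star_sub, star_smul, star_smul, star_one]
  simp only [star_natCast, star_ofNat, ← Complex.coe_smul]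
  push_cast
  module

/-- At the zero operator the Fejér polynomial has real part `N`; adding `(ρ - 1) N` to both sides of
the Harnack inequality therefore absorbs the constant term exactly. -/
lemma HarnackDominated.toeplitzSum_le {ρ : ℝ} {T S : H →L[ℂ] H} (h : HarnackDominated ρ T S) :
    ∃ c : ℝ, ∀ (N : ℕ) (z : ℂ), ‖z‖ = 1 →
      toeplitzSum ρ N (z • T) ≤ c ^ 2 • toeplitzSum ρ N (z • S) := by
  obtain ⟨c, -, hc⟩ := h
  refine ⟨c, fun N z hz => ?_⟩
  have := hc (fejerPoly N z) fun w hw => fejerPoly_eval_re_nonneg N hz hw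
  simp only [realPart_aeval_fejerPoly, smul_zero, cesaroSum_zero_right] at this
  have h2 := add_le_add_left this ((((ρ : ℂ) - 1) * N) • (1 : H →L[ℂ] H))
  unfold toeplitzSum
  convert h2 using 1
  · module
  · rw [star_smul, star_one, star_natCast]
    simp only [← Complex.coe_smul]
    push_cast
    module

/-- The sum is `ρ` times the compression to `H` of the positive Fejér sum of the unitary `z • U`.
The dilation formula fails at exponent `0`, which is what the summand `ρ - 2` corrects. -/
lemma toeplitzSum_nonneg {ρ : ℝ} (hρ : 0 ≤ ρ) {T : H →L[ℂ] H} (hT : IsRhoContraction ρ T)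
    (N : ℕ) {z : ℂ} (hz : ‖z‖ = 1) : 0 ≤ toeplitzSum ρ N (z • T) := by
  obtain ⟨K, _, _, _, J, U, hU, hk⟩ := hT
  have hzu : z • U ∈ unitary (K →L[ℂ] K) := by
    have h1 : star z * z = 1 := by
      rw [Complex.star_def, Complex.conj_mul', hz]; simp
    rw [Unitary.mem_iff] at hU ⊢
    rw [star_smul, smul_mul_smul_comm, smul_mul_smul_comm, hU.1, hU.2, mul_comm z, h1]
    simp
  have hpos := mul_star_self_nonneg (∑ i ∈ Finset.range N, (z • U) ^ i)
  rw [geom_mul_star_geom hzu, ContinuousLinearMap.nonneg_iff_isPositive] at hpos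
  have hpos2 := (hpos.adjoint_conj J.toContinuousLinearMap).smul_of_nonneg
    (c := (ρ : ℂ)) (by exact_mod_cast hρ)
  rw [ContinuousLinearMap.nonneg_iff_isPositive]
  convert hpos2 using 1
  set Φ : (K →L[ℂ] K) → (H →L[ℂ] H) := fun X =>
    (ContinuousLinearMap.adjoint J.toContinuousLinearMap) ∘L X ∘L J.toContinuousLinearMap with hΦ
  have hΦ1 : Φ 1 = 1 := by
    simp only [hΦ]
    ext x
    refine ext_inner_right ℂ fun y => ?_
    simp [ContinuousLinearMap.adjoint_inner_left]
  have hadd : ∀ X Y, Φ (X + Y) = Φ X + Φ Y := by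
    intro X Y; simp [hΦ, ContinuousLinearMap.add_comp, ContinuousLinearMap.comp_add]
  have hsmul : ∀ (a : ℂ) X, Φ (a • X) = a • Φ X := by
    intro a X; simp [hΦ, ContinuousLinearMap.smul_comp]
  have hstar : ∀ X, Φ (star X) = star (Φ X) := by
    intro X
    simp [hΦ, ContinuousLinearMap.star_eq_adjoint, ContinuousLinearMap.adjoint_comp,
      ContinuousLinearMap.comp_assoc]
  let Φl : (K →L[ℂ] K) →ₗ[ℂ] (H →L[ℂ] H) :=
    { toFun := Φ, map_add' := hadd, map_smul' := hsmul }
  have hpow : ∀ k, 1 ≤ k → (z • T) ^ k = (ρ : ℂ) • Φl ((z • U) ^ k) := by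
    intro k h1
    rw [smul_pow, smul_pow, hk k h1, map_smul, smul_comm]
    rfl
  have hQ : cesaroSum N (z • T) =
      (ρ : ℂ) • Φl (cesaroSum N (z • U)) + ((1 - (ρ : ℂ)) * N) • 1 := by
    rcases N with _ | N
    · simp [cesaroSum]
    · unfold cesaroSum
      rw [Finset.sum_range_succ', Finset.sum_range_succ', map_add, map_sum]
      have : Φl 1 = 1 := hΦ1
      simp only [pow_zero, map_smul, this, smul_add, Finset.smul_sum]
      rw [add_assoc]
      congr 1
      · refine Finset.sum_congr rfl fun j _ => ?_
        rw [hpow _ (by omega), smul_comm]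
      · push_cast
        module
  have hgoal : (ρ : ℂ) • Φl (cesaroSum N (z • U) + star (cesaroSum N (z • U)) - (N : ℂ) • 1) =
      toeplitzSum ρ N (z • T) := by
    have h1 : Φl 1 = 1 := hΦ1
    have hs : Φl (star (cesaroSum N (z • U))) = star (Φl (cesaroSum N (z • U))) := hstar _
    unfold toeplitzSum
    rw [hQ, map_sub, map_add, map_smul, h1, hs, star_add, star_smul, star_smul, star_one]
    simp only [Complex.star_def, map_mul, map_sub, map_one, Complex.conj_ofReal, Complex.conj_natCast]
    module
  exact hgoal.symm

end Hilbert

/-! ### Nilpotent operators: Fejér sums are affine in `N` -/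

/-- The self-adjoint element `2 Re (∑ j ≤ n, T ^ j) + ρ - 2`. -/
def rhoKernel {A : Type*} [Ring A] [StarRing A] [Algebra ℂ A] (ρ : ℝ) (n : ℕ) (T : A) : A :=
  ∑ j ∈ Finset.range (n + 1), T ^ j + star (∑ j ∈ Finset.range (n + 1), T ^ j) +
    ((ρ : ℂ) - 2) • 1

/-- The self-adjoint element `2 Re (∑ j ≤ n, j T ^ j)`. -/
def weightedReSum {A : Type*} [Ring A] [StarRing A] [Algebra ℂ A] (n : ℕ) (T : A) : A :=
  ∑ j ∈ Finset.range (n + 1), (j : ℂ) • T ^ j +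
    star (∑ j ∈ Finset.range (n + 1), (j : ℂ) • T ^ j)

lemma toeplitzSum_of_nilpotent {A : Type*} [Ring A] [StarRing A] [Algebra ℂ A] [StarModule ℂ A]
    (ρ : ℝ) {n N : ℕ} (hN : n + 1 ≤ N) {T : A} (hT : T ^ (n + 1) = 0) :
    toeplitzSum ρ N T = (N : ℂ) • rhoKernel ρ n T - weightedReSum n T := by
  have h : cesaroSum N T = (N : ℂ) • ∑ j ∈ Finset.range (n + 1), T ^ j -
      ∑ j ∈ Finset.range (n + 1), (j : ℂ) • T ^ j := by
    unfold cesaroSum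
    rw [Finset.smul_sum, ← Finset.sum_sub_distrib]
    symm
    refine (Finset.sum_congr rfl fun j _ => (sub_smul _ _ _).symm).trans
      (Finset.sum_subset (Finset.range_mono hN) fun j _ hj => ?_)
    rw [Finset.mem_range, not_lt] at hj
    rw [pow_eq_zero_of_le hj hT, smul_zero]
  unfold toeplitzSum rhoKernel weightedReSum
  rw [h, star_sub, star_smul, star_natCast]
  module

section Hilbert

variable {H : Type*} [NormedAddCommGroup H] [InnerProductSpace ℂ H] [CompleteSpace H]

lemma rhoKernel_nonneg_of_toeplitzSum_nonneg {ρ : ℝ} {n : ℕ} {T : H →L[ℂ] H}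
    (hT : T ^ (n + 1) = 0) (h : ∀ N, 0 ≤ toeplitzSum ρ N T) : 0 ≤ rhoKernel ρ n T := by
  have hlim : Filter.Tendsto (fun N : ℕ => ((N : ℝ)⁻¹) • toeplitzSum ρ N T) Filter.atTop
      (nhds (rhoKernel ρ n T)) := by
    have h1 : Filter.Tendsto (fun N : ℕ => rhoKernel ρ n T - ((N : ℝ)⁻¹) • weightedReSum n T)
        Filter.atTop (nhds (rhoKernel ρ n T - (0 : ℝ) • weightedReSum n T)) :=
      tendsto_const_nhds.sub (tendsto_inv_atTop_nhds_zero_nat.smul_const _)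
    rw [zero_smul, sub_zero] at h1
    refine h1.congr' ?_
    filter_upwards [Filter.eventually_ge_atTop (n + 1)] with N hN
    have hN0 : (N : ℂ) ≠ 0 := by
      have : N ≠ 0 := by omega
      exact_mod_cast this
    rw [toeplitzSum_of_nilpotent ρ hN hT]
    simp only [← Complex.coe_smul]
    push_cast
    rw [smul_sub, smul_smul, inv_mul_cancel₀ hN0, one_smul]
  have hcl : IsClosed {a : H →L[ℂ] H | 0 ≤ a} := CStarAlgebra.isClosed_nonneg
  exact hcl.mem_of_tendsto hlim (Filter.Eventually.of_forall fun N =>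
    smul_nonneg (by positivity) (h N))

/-- Factor `P = B* B`: the quadratic form is `‖B x‖ ^ 2` and `‖P‖ = ‖B‖ ^ 2`. -/
lemma norm_apply_sq_le_of_nonneg {P : H →L[ℂ] H} (hP : 0 ≤ P) (x : H) :
    ‖P x‖ ^ 2 ≤ ‖P‖ * (inner ℂ (P x) x).re := by
  obtain ⟨B, rfl⟩ := CStarAlgebra.nonneg_iff_eq_star_mul_self.1 hP
  have h1 : (inner ℂ ((star B * B) x) x).re = ‖B x‖ ^ 2 := by
    rw [mul_apply_eq_comp, ContinuousLinearMap.star_eq_adjoint,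
      ContinuousLinearMap.adjoint_inner_left, inner_self_eq_norm_sq_to_K]
    norm_cast
  rw [h1, CStarRing.norm_star_mul_self, mul_apply_eq_comp]
  have := (star B).le_opNorm (B x)
  rw [norm_star] at this
  calc ‖star B (B x)‖ ^ 2 ≤ (‖B‖ * ‖B x‖) ^ 2 := by gcongr
    _ = _ := by ring

/-- The gain is one power of `N`: the norm of the Fejér sum of `T` is `O(N)`, but on null vectors of
the kernel of `S` only the weighted term, independent of `N`, enters the quadratic form. Compactness
of the circle makes the constant uniform in `z`. -/
lemma HarnackDominated.exists_bound {ρ : ℝ} (hρ : 0 ≤ ρ) {n : ℕ} {T S : H →L[ℂ] H}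
    (hT : IsRhoContraction ρ T) (h : HarnackDominated ρ T S) (hS : S ^ (n + 1) = 0) :
    ∃ C : ℝ, 0 ≤ C ∧ ∀ (N : ℕ) (z : ℂ) (x : H), n + 1 ≤ N → ‖z‖ = 1 →
      rhoKernel ρ n (z • S) x = 0 → ‖toeplitzSum ρ N (z • T) x‖ ^ 2 ≤ C * N * ‖x‖ ^ 2 := by
  obtain ⟨c, hc⟩ := h.toeplitzSum_le
  have hK1 : Continuous fun z : ℂ => rhoKernel ρ n (z • S) := by
    unfold rhoKernel; fun_prop
  have hK2 : Continuous fun z : ℂ => weightedReSum n (z • S) := by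
    unfold weightedReSum; fun_prop
  obtain ⟨A, hA⟩ := (isCompact_sphere (0 : ℂ) 1).exists_bound_of_continuousOn hK1.continuousOn
  obtain ⟨B, hB⟩ := (isCompact_sphere (0 : ℂ) 1).exists_bound_of_continuousOn hK2.continuousOn
  have hA0 : 0 ≤ A := (norm_nonneg _).trans (hA 1 (by simp))
  have hB0 : 0 ≤ B := (norm_nonneg _).trans (hB 1 (by simp))
  refine ⟨c ^ 2 * (A + B) * (c ^ 2 * B), by positivity, fun N z x hN hz hx => ?_⟩
  have hzm : z ∈ Metric.sphere (0 : ℂ) 1 := by simpa using hz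
  have hN1 : (1 : ℝ) ≤ N := by exact_mod_cast (by omega : 1 ≤ N)
  have hP := toeplitzSum_nonneg hρ hT N hz
  have hle := hc N z hz
  have hR := toeplitzSum_of_nilpotent ρ hN (T := z • S) (by rw [smul_pow, hS, smul_zero])
  have hnorm : ‖toeplitzSum ρ N (z • T)‖ ≤ c ^ 2 * (A + B) * N := by
    refine (CStarAlgebra.norm_le_norm_of_nonneg_of_le hP hle).trans ?_
    rw [norm_smul, Real.norm_of_nonneg (by positivity), mul_assoc, hR]
    gcongr
    refine (norm_sub_le _ _).trans ?_
    rw [norm_smul, Complex.norm_natCast]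
    nlinarith [hA z hzm, hB z hzm]
  have hin : (inner ℂ (toeplitzSum ρ N (z • T) x) x).re ≤ c ^ 2 * B * ‖x‖ ^ 2 := by
    have h1 := ((ContinuousLinearMap.le_def _ _).1 hle).re_inner_nonneg_left x
    rw [sub_apply, inner_sub_left, map_sub, sub_nonneg,
      smul_apply, hR, sub_apply,
      smul_apply, hx, smul_zero, zero_sub] at h1
    refine h1.trans ((Complex.re_le_norm _).trans ((norm_inner_le_norm _ _).trans ?_))
    rw [norm_smul, Real.norm_of_nonneg (by positivity), norm_neg]
    have := (weightedReSum n (z • S)).le_of_opNorm_le (hB z hzm) x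
    calc c ^ 2 * ‖weightedReSum n (z • S) x‖ * ‖x‖ ≤ c ^ 2 * (B * ‖x‖) * ‖x‖ := by gcongr
      _ = _ := by ring
  have h0 : 0 ≤ (inner ℂ (toeplitzSum ρ N (z • T) x) x).re :=
    ((ContinuousLinearMap.nonneg_iff_isPositive _).1 hP).re_inner_nonneg_left x
  calc _ ≤ _ := norm_apply_sq_le_of_nonneg hP x
    _ ≤ (c ^ 2 * (A + B) * N) * (c ^ 2 * B * ‖x‖ ^ 2) := by gcongr
    _ = _ := by ring

end Hilbert

/-! ### Laurent polynomials with vector coefficients -/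

section Laurent

variable {E : Type*} [NormedAddCommGroup E] [NormedSpace ℂ E]

/-- Evaluation at `z` of a Laurent polynomial with coefficients in a vector space. -/
def laurentEval (z : ℂ) : (ℤ →₀ E) →ₗ[ℂ] E :=
  Finsupp.lsum ℂ fun d : ℤ => z ^ d • (LinearMap.id : E →ₗ[ℂ] E)

@[simp] lemma laurentEval_single (z : ℂ) (d : ℤ) (x : E) :
    laurentEval z (Finsupp.single d x) = z ^ d • x := by
  simp [laurentEval]

lemma integral_exp_int_mul (d : ℤ) :
    ∫ θ in (0 : ℝ)..2 * Real.pi, Complex.exp (θ * Complex.I) ^ d =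
      if d = 0 then ((2 * Real.pi : ℝ) : ℂ) else 0 := by
  split_ifs with h
  · subst h
    simp
  · have hd : (d : ℂ) * Complex.I ≠ 0 := mul_ne_zero (by exact_mod_cast h) Complex.I_ne_zero
    have : ∀ θ : ℝ, Complex.exp (θ * Complex.I) ^ d = Complex.exp (d * Complex.I * θ) := by
      intro θ
      rw [← Complex.exp_int_mul]
      congr 1
      ring
    simp only [this]
    rw [integral_exp_mul_complex hd]
    have h1 : Complex.exp (d * Complex.I * ((2 * Real.pi : ℝ) : ℂ)) = 1 := by
      rw [Complex.exp_eq_one_iff]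
      exact ⟨d, by push_cast; ring⟩
    rw [h1]
    simp

/-- The coefficient is the mean over the circle of `z ^ (-m)` times the value. -/
lemma norm_coeff_le_of_norm_laurentEval_le [CompleteSpace E] (g : ℤ →₀ E) {B : ℝ}
    (h : ∀ z : ℂ, ‖z‖ = 1 → ‖laurentEval z g‖ ≤ B) (m : ℤ) : ‖g m‖ ≤ B := by
  have hint : ∫ θ in (0 : ℝ)..2 * Real.pi, Complex.exp (θ * Complex.I) ^ (-m) •
      laurentEval (Complex.exp (θ * Complex.I)) g = ((2 * Real.pi : ℝ) : ℂ) • g m := by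
    have h1 : ∀ θ : ℝ, Complex.exp (θ * Complex.I) ^ (-m) •
        laurentEval (Complex.exp (θ * Complex.I)) g =
        ∑ d ∈ g.support, Complex.exp (θ * Complex.I) ^ (d - m) • g d := by
      intro θ
      rw [laurentEval, Finsupp.lsum_apply, Finsupp.sum, Finset.smul_sum]
      refine Finset.sum_congr rfl fun d _ => ?_
      rw [LinearMap.smul_apply, LinearMap.id_apply, smul_smul,
        ← zpow_add₀ (Complex.exp_ne_zero _)]
      congr 2
      ring
    simp only [h1]
    rw [intervalIntegral.integral_finsetSum]
    · simp only [intervalIntegral.integral_smul_const, integral_exp_int_mul, sub_eq_zero, ite_smul,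
        zero_smul, Finset.sum_ite_eq']
      split_ifs with h0
      · rfl
      · rw [Finsupp.notMem_support_iff.1 h0, smul_zero]
    · intro d _
      refine Continuous.intervalIntegrable ?_ _ _
      refine Continuous.smul (Continuous.zpow₀ (by fun_prop) _ fun θ =>
        Or.inl (Complex.exp_ne_zero _)) continuous_const
  have hle := intervalIntegral.norm_integral_le_of_norm_le_const (a := 0) (b := 2 * Real.pi)
    (C := B) (f := fun θ : ℝ => Complex.exp (θ * Complex.I) ^ (-m) •
      laurentEval (Complex.exp (θ * Complex.I)) g) (fun θ _ => by
        rw [norm_smul, norm_zpow, Complex.norm_exp_ofReal_mul_I, one_zpow, one_mul]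
        exact h _ (Complex.norm_exp_ofReal_mul_I θ))
  rw [hint, norm_smul, sub_zero, Complex.norm_real, Real.norm_eq_abs, mul_comm] at hle
  exact le_of_mul_le_mul_right hle (abs_pos.2 (by positivity))

end Laurent

/-! ### Coefficient relations from null vectors -/

section Hilbert

variable {H : Type*} [NormedAddCommGroup H] [InnerProductSpace ℂ H] [CompleteSpace H]

/-- The coefficients of the operator-valued trigonometric series
`ρ + 2 Re (∑ k ≥ 1, z ^ k T ^ k)`. -/
def symbolCoeff (ρ : ℝ) (T : H →L[ℂ] H) : ℤ → (H →L[ℂ] H)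
  | Int.ofNat 0 => (ρ : ℂ) • 1
  | Int.ofNat (k + 1) => T ^ (k + 1)
  | Int.negSucc k => star T ^ (k + 1)

lemma symbolCoeff_zero (ρ : ℝ) (T : H →L[ℂ] H) : symbolCoeff ρ T 0 = (ρ : ℂ) • 1 := rfl

lemma symbolCoeff_natCast (ρ : ℝ) (T : H →L[ℂ] H) {k : ℕ} (hk : k ≠ 0) :
    symbolCoeff ρ T k = T ^ k := by
  obtain ⟨k, rfl⟩ := Nat.exists_eq_succ_of_ne_zero hk
  rfl

lemma symbolCoeff_neg_natCast (ρ : ℝ) (T : H →L[ℂ] H) {k : ℕ} (hk : k ≠ 0) :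
    symbolCoeff ρ T (-k) = star T ^ k := by
  obtain ⟨k, rfl⟩ := Nat.exists_eq_succ_of_ne_zero hk
  rfl

lemma exists_natCast_or_neg (d : ℤ) : d = 0 ∨ (∃ k : ℕ, k ≠ 0 ∧ d = k) ∨
    ∃ k : ℕ, k ≠ 0 ∧ d = -(k : ℤ) := by
  rcases Int.lt_trichotomy d 0 with h | h | h
  · exact Or.inr (Or.inr ⟨d.natAbs, by omega, by omega⟩)
  · exact Or.inl h
  · exact Or.inr (Or.inl ⟨d.natAbs, by omega, by omega⟩)

/-- The Laurent polynomial `z ↦ (toeplitzSum ρ N (z T)) u`, for `z` on the unit circle. -/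
def toeplitzLaurent (ρ : ℝ) (T : H →L[ℂ] H) (N : ℕ) (s : ℤ) (u : H) : ℤ →₀ H :=
  ∑ j ∈ Finset.range N, ((N : ℂ) - j) • Finsupp.single (j + s) ((T ^ j) u) +
    ∑ j ∈ Finset.range N, ((N : ℂ) - j) • Finsupp.single (-j + s) ((star T ^ j) u) +
    (((ρ : ℂ) - 2) * N) • Finsupp.single s u

lemma laurentEval_toeplitzLaurent (ρ : ℝ) (T : H →L[ℂ] H) (N : ℕ) (s : ℤ) (u : H) {z : ℂ}
    (hz : ‖z‖ = 1) :
    laurentEval z (toeplitzLaurent ρ T N s u) = toeplitzSum ρ N (z • T) (z ^ s • u) := by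
  have hz0 : z ≠ 0 := by rintro rfl; simp at hz
  have hzs : star z = z⁻¹ := by
    rw [Complex.star_def, ← Complex.inv_eq_conj hz]
  unfold toeplitzLaurent toeplitzSum cesaroSum
  simp only [map_add, map_sum, map_smul, laurentEval_single, add_apply, smul_apply, star_sum,
    star_smul, star_pow, hzs, smul_pow, sum_apply, star_sub, star_natCast,
    one_apply_eq_self]
  rw [smul_add, smul_add]
  congr 1
  congr 1
  · rw [Finset.smul_sum]
    refine Finset.sum_congr rfl fun j _ => ?_
    rw [zpow_add₀ hz0, zpow_natCast, mul_smul]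
    simp only [smul_smul]
    congr 1
    ring
  · rw [Finset.smul_sum]
    refine Finset.sum_congr rfl fun j _ => ?_
    rw [zpow_add₀ hz0, zpow_neg, zpow_natCast, inv_pow]
    simp only [smul_smul]
    congr 1
    ring
  · exact smul_comm _ _ _

lemma toeplitzLaurent_apply (ρ : ℝ) (T : H →L[ℂ] H) {N : ℕ} (s : ℤ) (u : H) {m : ℤ}
    (hm : (m - s).natAbs < N) :
    toeplitzLaurent ρ T N s u m =
      ((N : ℂ) - (m - s).natAbs) • symbolCoeff ρ T (m - s) u := by
  obtain ⟨d, rfl⟩ : ∃ d, m = d + s := ⟨m - s, by ring⟩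
  rw [add_sub_cancel_right] at hm ⊢
  unfold toeplitzLaurent
  simp only [Finsupp.add_apply, Finsupp.coe_finsetSum, Finset.sum_apply, Finsupp.smul_apply,
    Finsupp.single_apply, add_left_inj, smul_ite, smul_zero]
  rcases exists_natCast_or_neg d with rfl | ⟨k, hk, rfl⟩ | ⟨k, hk, rfl⟩
  · have h1 : ∀ j : ℕ, ((j : ℤ) = 0) = (j = 0) := fun j => propext (by omega)
    have h2 : ∀ j : ℕ, (-(j : ℤ) = 0) = (j = 0) := fun j => propext (by omega)
    simp only [h1, h2, Finset.sum_ite_eq', Finset.mem_range, symbolCoeff_zero]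
    have h0 : 0 < N := by simpa using hm
    simp [h0]
    module
  · have h1 : ∀ j : ℕ, ((j : ℤ) = k) = (j = k) := fun j => propext (by omega)
    have h2 : ∀ j : ℕ, (-(j : ℤ) = k) = False := fun j => eq_false (by omega)
    have h3 : (s = k + s) = False := eq_false (by omega)
    have h0 : k < N := by simpa using hm
    simp only [h1, h2, h3, Finset.sum_ite_eq', Finset.mem_range, symbolCoeff_natCast ρ T hk, h0]
    simp
  · have h1 : ∀ j : ℕ, ((j : ℤ) = -k) = False := fun j => eq_false (by omega)
    have h2 : ∀ j : ℕ, (-(j : ℤ) = -k) = (j = k) := fun j => propext (by omega)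
    have h3 : (s = -k + s) = False := eq_false (by omega)
    have h0 : k < N := by simpa using hm
    simp only [h1, h2, h3, Finset.sum_ite_eq', Finset.mem_range, symbolCoeff_neg_natCast ρ T hk,
      h0]
    simp

lemma eq_zero_of_norm_natCast_smul_sub_sq_le {E : Type*} [NormedAddCommGroup E]
    [NormedSpace ℂ E] {w w' : E} {C : ℝ} {N₀ : ℕ}
    (h : ∀ N : ℕ, N₀ ≤ N → ‖(N : ℂ) • w - w'‖ ^ 2 ≤ C * N) : w = 0 := by
  by_contra hw
  have hw0 : 0 < ‖w‖ ^ 2 := by positivity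
  obtain ⟨M, hM⟩ := exists_nat_gt ((2 * |C| + 2 * ‖w'‖ ^ 2) / ‖w‖ ^ 2)
  rw [div_lt_iff₀ hw0] at hM
  set N := max M (max N₀ 1) with hN
  have h1 : (1 : ℝ) ≤ N := by exact_mod_cast (by omega : 1 ≤ N)
  have hMN : (M : ℝ) ≤ N := by exact_mod_cast (by omega : M ≤ N)
  have h2 := h N (by omega)
  have h3 : ‖(N : ℂ) • w‖ ≤ ‖(N : ℂ) • w - w'‖ + ‖w'‖ := by
    simpa using norm_add_le ((N : ℂ) • w - w') w'
  rw [norm_smul, Complex.norm_natCast] at h3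
  have h4 : (N * ‖w‖) ^ 2 ≤ 2 * ‖(N : ℂ) • w - w'‖ ^ 2 + 2 * ‖w'‖ ^ 2 := by
    have : (N * ‖w‖) ^ 2 ≤ (‖(N : ℂ) • w - w'‖ + ‖w'‖) ^ 2 := by gcongr
    nlinarith [sq_nonneg (‖(N : ℂ) • w - w'‖ - ‖w'‖)]
  have h5 : C * N ≤ |C| * N := by gcongr; exact le_abs_self C
  have h6 : ‖w'‖ ^ 2 ≤ ‖w'‖ ^ 2 * N := le_mul_of_one_le_right (by positivity) h1
  have h7 : N * (N * ‖w‖ ^ 2) ≤ N * (2 * |C| + 2 * ‖w'‖ ^ 2) := by nlinarith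
  have h8 : N * ‖w‖ ^ 2 ≤ 2 * |C| + 2 * ‖w'‖ ^ 2 := le_of_mul_le_mul_left h7 (by linarith)
  have h9 : (M : ℝ) * ‖w‖ ^ 2 ≤ N * ‖w‖ ^ 2 := by gcongr
  linarith

/-- If `S` is nilpotent and the kernel of `S` at every `z` of the unit circle annihilates the
Laurent polynomial `∑ k, z ^ (-k) u k`, then so does the kernel of every `ρ`-contraction dominated
by `S`, coefficient by coefficient. -/
lemma HarnackDominated.sum_symbolCoeff_eq_zero {ρ : ℝ} (hρ : 0 ≤ ρ) {n : ℕ} {T S : H →L[ℂ] H}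
    (hT : IsRhoContraction ρ T) (h : HarnackDominated ρ T S) (hS : S ^ (n + 1) = 0)
    (u : Fin (n + 1) → H)
    (hu : ∀ z : ℂ, ‖z‖ = 1 →
      rhoKernel ρ n (z • S) (∑ k : Fin (n + 1), z ^ (-(k : ℤ)) • u k) = 0) (m : ℤ) :
    ∑ k : Fin (n + 1), symbolCoeff ρ T (m + k) (u k) = 0 := by
  obtain ⟨C, hC0, hC⟩ := h.exists_bound hρ hT hS
  -- The `m`-th Laurent coefficient is `N w - w'` with `w` the desired sum. The threshold on `N`
  -- keeps every index `m + k` inside the Fejér window and exceeds the nilpotency order.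
  refine eq_zero_of_norm_natCast_smul_sub_sq_le (C := C * (∑ k, ‖u k‖) ^ 2)
    (w' := ∑ k : Fin (n + 1), ((m + k).natAbs : ℂ) • symbolCoeff ρ T (m + k) (u k))
    (N₀ := m.natAbs + n + 1) fun N hN => ?_
  set g : ℤ →₀ H := ∑ k : Fin (n + 1), toeplitzLaurent ρ T N (-(k : ℤ)) (u k) with hg
  have hgm : g m = (N : ℂ) • ∑ k : Fin (n + 1), symbolCoeff ρ T (m + k) (u k) -
      ∑ k : Fin (n + 1), ((m + k).natAbs : ℂ) • symbolCoeff ρ T (m + k) (u k) := by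
    rw [hg, Finsupp.coe_finsetSum, Finset.sum_apply, Finset.smul_sum, ← Finset.sum_sub_distrib]
    refine Finset.sum_congr rfl fun k _ => ?_
    rw [toeplitzLaurent_apply _ _ _ _ (by omega), sub_neg_eq_add, sub_smul]
  rw [← hgm]
  have hle : ‖g m‖ ≤ Real.sqrt (C * (∑ k, ‖u k‖) ^ 2 * N) := by
    refine norm_coeff_le_of_norm_laurentEval_le g (fun z hz => ?_) m
    have hev : laurentEval z g = toeplitzSum ρ N (z • T) (∑ k : Fin (n + 1), z ^ (-(k : ℤ)) • u k) := by
      rw [hg, map_sum, map_sum]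
      exact Finset.sum_congr rfl fun k _ => laurentEval_toeplitzLaurent _ _ _ _ _ hz
    rw [hev]
    refine Real.le_sqrt_of_sq_le ((hC N z _ (by omega) hz (hu z hz)).trans ?_)
    have hx : ‖∑ k : Fin (n + 1), z ^ (-(k : ℤ)) • u k‖ ≤ ∑ k, ‖u k‖ := by
      refine norm_sum_le_of_le _ fun k _ => ?_
      rw [norm_smul, norm_zpow, hz, one_zpow, one_mul]
    calc C * N * ‖∑ k : Fin (n + 1), z ^ (-(k : ℤ)) • u k‖ ^ 2
        ≤ C * N * (∑ k, ‖u k‖) ^ 2 := by gcongr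
      _ = _ := by ring
  calc ‖g m‖ ^ 2 ≤ Real.sqrt (C * (∑ k, ‖u k‖) ^ 2 * N) ^ 2 := by gcongr
    _ = _ := Real.sq_sqrt (by positivity)

end Hilbert

/-! ### Truncated shifts and null vectors of their kernels -/

lemma one_sub_star_mul_star_geom {A : Type*} [Ring A] [StarRing A] {x : A} {m : ℕ}
    (hx : x ^ m = 0) : (1 - star x) * star (∑ j ∈ Finset.range m, x ^ j) = 1 := by
  rw [star_sum]
  simp only [star_pow]
  rw [mul_neg_geom_sum, ← star_pow, hx, star_zero, sub_zero]

lemma truncatedShift_apply (m : ℕ) (b : ℂ) (x : EuclideanSpace ℂ (Fin m)) (i : Fin m) :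
    truncatedShift m b x i = if h : (i : ℕ) + 1 < m then b * x ⟨i + 1, h⟩ else 0 := by
  rw [truncatedShift, Matrix.ofLp_toEuclideanCLM]
  simp only [Matrix.mulVec, dotProduct, Matrix.of_apply, ite_mul, zero_mul]
  split_ifs with h
  · rw [Finset.sum_eq_single ⟨i + 1, h⟩]
    · simp
    · intro j _ hj
      rw [if_neg fun h' => hj (Fin.ext h')]
    · simp
  · refine Finset.sum_eq_zero fun j _ => if_neg fun h' => h (by rw [← h']; exact j.2)

lemma star_truncatedShift_apply (m : ℕ) (b : ℂ) (x : EuclideanSpace ℂ (Fin m)) (i : Fin m) :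
    star (truncatedShift m b) x i =
      if h : 1 ≤ (i : ℕ) then star b * x ⟨i - 1, by omega⟩ else 0 := by
  rw [truncatedShift, ← map_star, Matrix.ofLp_toEuclideanCLM, Matrix.star_eq_conjTranspose]
  simp only [Matrix.mulVec, dotProduct, Matrix.conjTranspose_apply, Matrix.of_apply]
  split_ifs with h
  · rw [Finset.sum_eq_single ⟨i - 1, by omega⟩]
    · rw [if_pos (by simp; omega)]
    · intro j _ hj
      rw [if_neg fun h' => hj (Fin.ext (by simp; omega)), star_zero, zero_mul]
    · simp
  · refine Finset.sum_eq_zero fun j _ => ?_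
    rw [if_neg (by omega), star_zero, zero_mul]

lemma truncatedShift_pow_apply (m : ℕ) (b : ℂ) (j : ℕ) (x : EuclideanSpace ℂ (Fin m))
    (i : Fin m) :
    (truncatedShift m b ^ j) x i = if h : (i : ℕ) + j < m then b ^ j * x ⟨i + j, h⟩ else 0 := by
  induction j generalizing i with
  | zero => simp
  | succ j ih =>
    rw [pow_succ', mul_apply_eq_comp, truncatedShift_apply]
    split_ifs with h1 h2 h2
    · rw [ih, dif_pos (by simp only; omega), pow_succ', mul_assoc]
      exact congrArg (fun t => b * (b ^ j * x t)) (Fin.ext (by simp only; omega))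
    · rw [ih, dif_neg (by simp only; omega), mul_zero]
    · omega
    · rfl

lemma truncatedShift_pow_self (m : ℕ) (b : ℂ) : truncatedShift m b ^ m = 0 := by
  ext x i
  rw [truncatedShift_pow_apply, dif_neg (by omega)]
  rfl

lemma truncatedShift_eq_smul (m : ℕ) (b : ℂ) : truncatedShift m b = b • truncatedShift m 1 := by
  ext x i
  simp [truncatedShift_apply]

section

variable {n : ℕ}

@[simp] lemma truncatedShift_apply_castSucc (b : ℂ) (x : EuclideanSpace ℂ (Fin (n + 1)))
    (i : Fin n) : truncatedShift (n + 1) b x i.castSucc = b * x i.succ := by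
  rw [truncatedShift_apply, dif_pos (by simp)]
  rfl

@[simp] lemma truncatedShift_apply_last (b : ℂ) (x : EuclideanSpace ℂ (Fin (n + 1))) :
    truncatedShift (n + 1) b x (Fin.last n) = 0 := by
  rw [truncatedShift_apply, dif_neg (by simp)]

@[simp] lemma star_truncatedShift_apply_succ (b : ℂ) (x : EuclideanSpace ℂ (Fin (n + 1)))
    (i : Fin n) : star (truncatedShift (n + 1) b) x i.succ = star b * x i.castSucc := by
  rw [star_truncatedShift_apply, dif_pos (by simp)]
  rfl

@[simp] lemma star_truncatedShift_apply_zero (b : ℂ) (x : EuclideanSpace ℂ (Fin (n + 1))) :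
    star (truncatedShift (n + 1) b) x 0 = 0 := by
  rw [star_truncatedShift_apply, dif_neg (by simp)]

/-- With `g = (1 - S)⁻¹ v` and `h = (1 - S*)⁻¹ v`, the null equation becomes a pair of two-term
recursions linked by a coordinatewise relation. -/
lemma rhoKernel_apply_eq_zero {ρ : ℝ} {b : ℂ} {v : EuclideanSpace ℂ (Fin (n + 1))}
    (hv : rhoKernel ρ n (truncatedShift (n + 1) b) v = 0) :
    ∃ g h : EuclideanSpace ℂ (Fin (n + 1)), g - truncatedShift (n + 1) b g = v ∧
      h - star (truncatedShift (n + 1) b) h = v ∧ ∀ i, g i + h i + ((ρ : ℂ) - 2) * v i = 0 := by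
  set S := truncatedShift (n + 1) b with hS
  have h1 : (1 - S) * ∑ j ∈ Finset.range (n + 1), S ^ j = 1 := by
    rw [mul_neg_geom_sum, hS, truncatedShift_pow_self, sub_zero]
  have h2 : (1 - star S) * star (∑ j ∈ Finset.range (n + 1), S ^ j) = 1 :=
    one_sub_star_mul_star_geom (truncatedShift_pow_self _ _)
  refine ⟨(∑ j ∈ Finset.range (n + 1), S ^ j) v, star (∑ j ∈ Finset.range (n + 1), S ^ j) v,
    DFunLike.congr_fun h1 v, DFunLike.congr_fun h2 v, fun i => ?_⟩
  have := congrArg (fun w : EuclideanSpace ℂ (Fin (n + 1)) => w i) hv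
  simpa only [rhoKernel, add_apply, smul_apply, one_apply_eq_self, PiLp.add_apply,
    PiLp.smul_apply, smul_eq_mul, PiLp.zero_apply] using this

/-- A null vector of the kernel of a nonzero truncated shift has nonzero first coordinate. -/
lemma eq_zero_of_rhoKernel_apply_eq_zero_of_zero {ρ : ℝ} (hρ : ρ ≠ 1) {b : ℂ} (hb : b ≠ 0)
    {v : EuclideanSpace ℂ (Fin (n + 1))}
    (hv : rhoKernel ρ n (truncatedShift (n + 1) b) v = 0) (h0 : v 0 = 0) : v = 0 := by
  obtain ⟨g, h, hg, hh, hsum⟩ := rhoKernel_apply_eq_zero hv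
  have hρ' : (ρ : ℂ) - 1 ≠ 0 := sub_ne_zero.2 (by exact_mod_cast hρ)
  have key : ∀ i, v i = 0 ∧ g i = 0 ∧ h i = 0 := by
    intro i
    induction i using Fin.induction with
    | zero =>
      have e1 : h 0 = v 0 := by simpa using congrArg (fun w => w 0) hh
      have e2 := hsum 0
      rw [e1, h0] at e2
      exact ⟨h0, by simpa using e2, by rw [e1, h0]⟩
    | succ i ih =>
      obtain ⟨i1, i2, i3⟩ := ih
      have e1 : g i.castSucc - b * g i.succ = v i.castSucc := by
        simpa using congrArg (fun w => w i.castSucc) hg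
      have e2 : h i.succ - star b * h i.castSucc = v i.succ := by
        simpa using congrArg (fun w => w i.succ) hh
      have e3 := hsum i.succ
      -- Here `b ≠ 0` forces the next `g` to vanish and the next `h` equals the next `v`, so the
      -- linking relation reads `(ρ - 1) v = 0`.
      rw [i1, i2, zero_sub, neg_eq_zero, mul_eq_zero, or_iff_right hb] at e1
      rw [i3, mul_zero, sub_zero] at e2
      rw [e1, e2] at e3
      have e4 : ((ρ : ℂ) - 1) * v i.succ = 0 := by linear_combination e3
      have e5 := (mul_eq_zero.1 e4).resolve_left hρ'
      exact ⟨e5, e1, e2.trans e5⟩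
  ext i
  exact (key i).1

/-- A null vector of the kernel of a nonzero truncated shift has nonzero last coordinate. -/
lemma eq_zero_of_rhoKernel_apply_eq_zero_of_last {ρ : ℝ} (hρ : ρ ≠ 1) {b : ℂ} (hb : b ≠ 0)
    {v : EuclideanSpace ℂ (Fin (n + 1))}
    (hv : rhoKernel ρ n (truncatedShift (n + 1) b) v = 0) (h0 : v (Fin.last n) = 0) : v = 0 := by
  obtain ⟨g, h, hg, hh, hsum⟩ := rhoKernel_apply_eq_zero hv
  have hρ' : (ρ : ℂ) - 1 ≠ 0 := sub_ne_zero.2 (by exact_mod_cast hρ)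
  have hb' : star b ≠ 0 := by simpa using hb
  have key : ∀ i, v i = 0 ∧ g i = 0 ∧ h i = 0 := by
    intro i
    induction i using Fin.reverseInduction with
    | last =>
      have e1 : g (Fin.last n) = v (Fin.last n) := by
        simpa using congrArg (fun w => w (Fin.last n)) hg
      have e2 := hsum (Fin.last n)
      rw [e1, h0] at e2
      exact ⟨h0, by rw [e1, h0], by simpa using e2⟩
    | cast i ih =>
      obtain ⟨i1, i2, i3⟩ := ih
      have e1 : g i.castSucc - b * g i.succ = v i.castSucc := by
        simpa using congrArg (fun w => w i.castSucc) hg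
      have e2 : h i.succ - star b * h i.castSucc = v i.succ := by
        simpa using congrArg (fun w => w i.succ) hh
      have e3 := hsum i.castSucc
      rw [i1, i3, zero_sub, neg_eq_zero, mul_eq_zero, or_iff_right hb'] at e2
      rw [i2, mul_zero, sub_zero] at e1
      rw [e1, e2] at e3
      have e4 : ((ρ : ℂ) - 1) * v i.castSucc = 0 := by linear_combination e3
      have e5 := (mul_eq_zero.1 e4).resolve_left hρ'
      exact ⟨e5, e1.trans e5, e2⟩
  ext i
  exact (key i).1

/-- The diagonal unitary with entries `z ^ (-k)` intertwines `S` with `z • S`, and their adjoints,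
hence the two kernels. -/
lemma rhoKernel_smul_truncatedShift_apply {ρ : ℝ} {b : ℂ} {v : EuclideanSpace ℂ (Fin (n + 1))}
    (hv : rhoKernel ρ n (truncatedShift (n + 1) b) v = 0) {z : ℂ} (hz : ‖z‖ = 1) :
    rhoKernel ρ n (z • truncatedShift (n + 1) b)
      (∑ k : Fin (n + 1), z ^ (-(k : ℤ)) • v k • EuclideanSpace.single k (1 : ℂ)) = 0 := by
  set S := truncatedShift (n + 1) b with hS
  have hz0 : z ≠ 0 := by rintro rfl; simp at hz
  have hzs : star z = z⁻¹ := by rw [Complex.star_def, ← Complex.inv_eq_conj hz]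
  set D : EuclideanSpace ℂ (Fin (n + 1)) →L[ℂ] EuclideanSpace ℂ (Fin (n + 1)) :=
    Matrix.toEuclideanCLM (n := Fin (n + 1)) (𝕜 := ℂ)
      (Matrix.diagonal fun k : Fin (n + 1) => z ^ (-(k : ℤ))) with hD
  have hDx : ∀ x i, D x i = z ^ (-(i : ℤ)) * x i := by
    intro x i
    rw [hD, Matrix.ofLp_toEuclideanCLM, Matrix.mulVec_diagonal]
  have hx : ∑ k : Fin (n + 1), z ^ (-(k : ℤ)) • v k • EuclideanSpace.single k (1 : ℂ) = D v := by
    ext i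
    rw [hDx]
    simp [Finset.sum_apply, Pi.single_apply]
  have h1 : SemiconjBy D S (z • S) := by
    ext x i
    simp only [mul_apply_eq_comp, smul_apply, hDx, PiLp.smul_apply, smul_eq_mul]
    refine Fin.lastCases ?_ (fun i => ?_) i
    · simp [hS]
    · simp only [hS, truncatedShift_apply_castSucc, hDx, Fin.val_castSucc, Fin.val_succ]
      push_cast
      rw [neg_add, zpow_add₀ hz0, zpow_neg_one]
      field_simp
  have h2 : SemiconjBy D (star S) (star (z • S)) := by
    ext x i
    simp only [mul_apply_eq_comp, smul_apply, star_smul, hDx, PiLp.smul_apply, smul_eq_mul, hzs]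
    refine Fin.cases ?_ (fun i => ?_) i
    · simp [hS]
    · simp only [hS, star_truncatedShift_apply_succ, hDx, Fin.val_castSucc, Fin.val_succ]
      push_cast
      rw [neg_add, zpow_add₀ hz0, zpow_neg_one]
      ring
  have h3 : D * rhoKernel ρ n S = rhoKernel ρ n (z • S) * D := by
    unfold rhoKernel
    rw [star_sum, star_sum, mul_add, mul_add, add_mul, add_mul, Finset.mul_sum, Finset.mul_sum,
      Finset.sum_mul, Finset.sum_mul, mul_smul_one, smul_one_mul]
    congr 1
    congr 1
    · exact Finset.sum_congr rfl fun j _ => h1.pow_right j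
    · refine Finset.sum_congr rfl fun j _ => ?_
      rw [star_pow, star_pow]
      exact h2.pow_right j
  rw [hx]
  have h4 := DFunLike.congr_fun h3 v
  rw [mul_apply_eq_comp, mul_apply_eq_comp, hv, map_zero] at h4
  exact h4.symm

end

/-! ### Unitary dilation of a truncated shift -/

section Shift

variable {ι E : Type*} [NormedAddCommGroup E] [InnerProductSpace ℂ E]

/-- Reindexing of `ℓ²` families along a permutation of the index set. -/
def lpReindex (σ : Equiv.Perm ι) : lp (fun _ : ι => E) 2 ≃ₗᵢ[ℂ] lp (fun _ : ι => E) 2 where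
  toFun f := ⟨fun i => f (σ i), memℓp_gen <|
    (σ.summable_iff (f := fun i => ‖f i‖ ^ ((2 : ENNReal).toReal))).2
      ((lp.memℓp f).summable (by norm_num))⟩
  invFun f := ⟨fun i => f (σ.symm i), memℓp_gen <|
    (σ.symm.summable_iff (f := fun i => ‖f i‖ ^ ((2 : ENNReal).toReal))).2
      ((lp.memℓp f).summable (by norm_num))⟩
  map_add' f g := by ext i; rfl
  map_smul' c f := by ext i; rfl
  left_inv f := by
    ext i
    exact congrArg f (σ.apply_symm_apply i)
  right_inv f := by
    ext i
    exact congrArg f (σ.symm_apply_apply i)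
  norm_map' f := by
    have hp : 0 < (2 : ENNReal).toReal := by norm_num
    rw [lp.norm_eq_tsum_rpow hp, lp.norm_eq_tsum_rpow hp]
    congr 1
    exact σ.tsum_eq fun i => ‖f i‖ ^ ((2 : ENNReal).toReal)

variable [CompleteSpace E]

/-- The bilateral backward shift on `ℓ²(ℤ, E)`. -/
def bilateralShift (E : Type*) [NormedAddCommGroup E] [InnerProductSpace ℂ E] [CompleteSpace E] :
    lp (fun _ : ℤ => E) 2 →L[ℂ] lp (fun _ : ℤ => E) 2 :=
  Unitary.linearIsometryEquiv.symm (lpReindex (E := E) (Equiv.addRight (1 : ℤ)))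

lemma bilateralShift_mem_unitary : bilateralShift E ∈ unitary _ :=
  (Unitary.linearIsometryEquiv.symm (lpReindex (E := E) (Equiv.addRight (1 : ℤ)))).2

lemma bilateralShift_pow_apply (j : ℕ) (f : lp (fun _ : ℤ => E) 2) (d : ℤ) :
    (bilateralShift E ^ j) f d = f (d + j) := by
  induction j generalizing d with
  | zero => simp
  | succ j ih =>
    rw [pow_succ', mul_apply_eq_comp]
    have : ∀ g : lp (fun _ : ℤ => E) 2, bilateralShift E g d = g (d + 1) := fun g => rfl
    rw [this, ih]
    exact congrArg (fun t : ℤ => f t) (by push_cast; ring)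

end Shift

/-- The kernel is a Toeplitz matrix with diagonal `ρ`; these entries reproduce the powers of `S` in
the dilation. -/
lemma inner_rhoKernel_single {n : ℕ} (ρ b : ℝ) {k l : Fin (n + 1)} {j : ℕ}
    (h : (k : ℕ) = l + j) :
    inner ℂ (rhoKernel ρ n (truncatedShift (n + 1) (b : ℂ)) (EuclideanSpace.single k 1))
      (EuclideanSpace.single l 1) = if j = 0 then (ρ : ℂ) else (b : ℂ) ^ j := by
  set S := truncatedShift (n + 1) (b : ℂ) with hS
  have hSi : ∀ (i : ℕ) (k l : Fin (n + 1)),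
      (S ^ i) (EuclideanSpace.single k 1) l = if (k : ℕ) = l + i then (b : ℂ) ^ i else 0 := by
    intro i k l
    rw [hS, truncatedShift_pow_apply]
    split_ifs with h1 h2 h2
    · rw [PiLp.single_apply, if_pos (Fin.ext h2.symm), mul_one]
    · rw [PiLp.single_apply, if_neg fun h' => h2 (by rw [← h']), mul_zero]
    · omega
    · rfl
  have h1 : inner ℂ ((∑ i ∈ Finset.range (n + 1), S ^ i) (EuclideanSpace.single k 1))
      (EuclideanSpace.single l (1 : ℂ)) = (b : ℂ) ^ j := by
    rw [EuclideanSpace.inner_single_right, one_mul, sum_apply]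
    simp only [WithLp.ofLp_sum, Finset.sum_apply, hSi]
    rw [Finset.sum_eq_single j]
    · simp [h]
    · intro i _ hij
      rw [if_neg (by omega)]
    · intro hj
      rw [Finset.mem_range] at hj
      omega
  have h2 : inner ℂ ((star (∑ i ∈ Finset.range (n + 1), S ^ i)) (EuclideanSpace.single k 1))
      (EuclideanSpace.single l (1 : ℂ)) = if j = 0 then 1 else 0 := by
    rw [ContinuousLinearMap.star_eq_adjoint, ContinuousLinearMap.adjoint_inner_left,
      EuclideanSpace.inner_single_left, map_one, one_mul, sum_apply]
    simp only [WithLp.ofLp_sum, Finset.sum_apply, hSi]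
    split_ifs with hj
    · rw [Finset.sum_eq_single 0]
      · simp [h, hj]
      · intro i _ hi
        rw [if_neg (by omega)]
      · simp
    · exact Finset.sum_eq_zero fun i _ => if_neg (by omega)
  have h3 : inner ℂ (EuclideanSpace.single k (1 : ℂ)) (EuclideanSpace.single l (1 : ℂ)) =
      if j = 0 then (1 : ℂ) else 0 := by
    rw [EuclideanSpace.inner_single_left, map_one, one_mul, PiLp.single_apply]
    congr 1
    exact propext ⟨fun h' => by rw [h'] at h; omega, fun h' => Fin.ext (by omega)⟩
  rw [rhoKernel, add_apply, add_apply, inner_add_left, inner_add_left, h1, h2, smul_apply,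
    one_apply_eq_self, inner_smul_left, h3, map_sub, Complex.conj_ofReal, Complex.conj_ofNat]
  split_ifs with hj
  · rw [hj]
    ring
  · ring

/-- Positivity of the kernel of a truncated shift gives a unitary `ρ`-dilation. -/
lemma isRhoContraction_of_rhoKernel_nonneg {n : ℕ} {ρ : ℝ} (hρ : 0 < ρ) {b : ℝ}
    (hb : 0 ≤ rhoKernel ρ n (truncatedShift (n + 1) (b : ℂ))) :
    IsRhoContraction ρ (truncatedShift (n + 1) (b : ℂ)) := by
  obtain ⟨B, hB⟩ := CStarAlgebra.nonneg_iff_eq_star_mul_self.1 hb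
  set E := EuclideanSpace ℂ (Fin (n + 1)) with hE
  set S := truncatedShift (n + 1) (b : ℂ) with hS
  have hBin : ∀ x y : E, inner ℂ (B x) (B y) = inner ℂ (rhoKernel ρ n S x) y := by
    intro x y
    rw [hB, mul_apply_eq_comp, ContinuousLinearMap.star_eq_adjoint,
      ContinuousLinearMap.adjoint_inner_left]
  set e : Fin (n + 1) → E := fun k => EuclideanSpace.single k (1 : ℂ) with he
  set r : ℂ := (((Real.sqrt ρ)⁻¹ : ℝ) : ℂ) with hr
  have hrr : star r * r * ρ = 1 := by
    rw [hr, Complex.star_def, Complex.conj_ofReal]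
    norm_cast
    rw [← mul_inv, Real.mul_self_sqrt hρ.le, inv_mul_cancel₀ hρ.ne']
  -- With the kernel factored as `B* B`, the vector `e_k` goes to `ρ ^ (-1/2) B e_k` placed at site
  -- `k`. Different sites are orthogonal, so only entries with `k = l + j` survive a shift by `j`.
  set J₀ : E →ₗ[ℂ] lp (fun _ : ℤ => E) 2 :=
    { toFun := fun x => ∑ k : Fin (n + 1), lp.single 2 (k : ℤ) ((x k * r) • B (e k))
      map_add' := by
        intro x y
        rw [← Finset.sum_add_distrib]
        refine Finset.sum_congr rfl fun k _ => ?_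
        rw [← lp.single_add, PiLp.add_apply, add_mul, add_smul]
      map_smul' := by
        intro c x
        rw [Finset.smul_sum]
        refine Finset.sum_congr rfl fun k _ => ?_
        rw [RingHom.id_apply, ← lp.single_smul, PiLp.smul_apply, smul_eq_mul, mul_assoc, mul_smul] }
    with hJ₀
  have hJapp : ∀ x (d : ℤ), J₀ x d =
      ∑ k : Fin (n + 1), if d = (k : ℤ) then (x k * r) • B (e k) else 0 := by
    intro x d
    simp only [hJ₀, LinearMap.coe_mk, AddHom.coe_mk, lp.coeFn_sum, Finset.sum_apply,
      lp.single_apply, Pi.single_apply]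
  have hmain : ∀ (j : ℕ) (x y : E),
      (ρ : ℂ) * inner ℂ ((bilateralShift E ^ j) (J₀ x)) (J₀ y) =
        ∑ l : Fin (n + 1), ∑ k : Fin (n + 1), if (k : ℕ) = l + j then
          star (x k) * y l * (if j = 0 then (ρ : ℂ) else (b : ℂ) ^ j) else 0 := by
    intro j x y
    have : J₀ y = ∑ k : Fin (n + 1), lp.single 2 (k : ℤ) ((y k * r) • B (e k)) := rfl
    rw [this, inner_sum, Finset.mul_sum]
    refine Finset.sum_congr rfl fun l _ => ?_
    rw [lp.inner_single_right, bilateralShift_pow_apply, hJapp, sum_inner, Finset.mul_sum]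
    refine Finset.sum_congr rfl fun k _ => ?_
    have hiff : ((l : ℤ) + j = k) = ((k : ℕ) = l + j) := propext (by omega)
    simp only [hiff]
    by_cases h1 : (k : ℕ) = l + j
    · rw [if_pos h1, if_pos h1, ← inner_rhoKernel_single ρ b h1, inner_smul_left, inner_smul_right, hBin, map_mul,
        ← Complex.star_def]
      linear_combination (star (x k) * y l * inner ℂ (rhoKernel ρ n S (e k)) (e l)) * hrr
    · rw [if_neg h1, if_neg h1, inner_zero_left, mul_zero]
  -- Isometry is the case `j = 0`: the diagonal entries `ρ` cancel the normalization.
  have hJnorm : ∀ x, ‖J₀ x‖ = ‖x‖ := by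
    intro x
    have h1 := hmain 0 x x
    have h2 : ∑ l : Fin (n + 1), ∑ k : Fin (n + 1), (if (k : ℕ) = l + 0 then
        star (x k) * x l * (if 0 = 0 then (ρ : ℂ) else (b : ℂ) ^ 0) else 0) =
        (ρ : ℂ) * inner ℂ x x := by
      rw [PiLp.inner_apply, Finset.mul_sum]
      refine Finset.sum_congr rfl fun l _ => ?_
      simp only [add_zero, Fin.val_inj, Finset.sum_ite_eq', Finset.mem_univ, if_true,
        RCLike.inner_apply, Complex.star_def]
      ring
    rw [h2, pow_zero, one_apply_eq_self] at h1
    have h3 := mul_left_cancel₀ (Complex.ofReal_ne_zero.2 hρ.ne') h1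
    rw [inner_self_eq_norm_sq_to_K, inner_self_eq_norm_sq_to_K] at h3
    exact (sq_eq_sq₀ (norm_nonneg _) (norm_nonneg _)).1 (by exact_mod_cast h3)
  refine ⟨lp (fun _ : ℤ => E) 2, inferInstance, inferInstance, inferInstance, ⟨J₀, hJnorm⟩,
    bilateralShift E, bilateralShift_mem_unitary, fun j hj => ?_⟩
  ext1 x
  refine ext_inner_right ℂ fun y => ?_
  rw [smul_apply, inner_smul_left, Complex.conj_ofReal, ContinuousLinearMap.comp_apply,
    ContinuousLinearMap.adjoint_inner_left]
  refine Eq.trans ?_ (hmain j x y).symm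
  rw [PiLp.inner_apply]
  refine Finset.sum_congr rfl fun l _ => ?_
  rw [hS, truncatedShift_pow_apply, RCLike.inner_apply]
  by_cases h1 : (l : ℕ) + j < n + 1
  · rw [dif_pos h1, Finset.sum_eq_single ⟨l + j, h1⟩]
    · rw [if_pos rfl, if_neg (by omega)]
      simp only [map_mul, map_pow, Complex.conj_ofReal, Complex.star_def]
      ring
    · intro k _ hk
      exact if_neg fun h' => hk (Fin.ext h')
    · simp
  · rw [dif_neg h1, Finset.sum_eq_zero fun k _ => if_neg (by omega), map_zero, mul_zero]

lemma IsRhoContraction.norm_apply_le.{u} {H : Type u} [NormedAddCommGroup H]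
    [InnerProductSpace ℂ H] [CompleteSpace H] {ρ : ℝ} (hρ : 0 ≤ ρ) {T : H →L[ℂ] H}
    (hT : IsRhoContraction ρ T) (x : H) : ‖T x‖ ≤ ρ * ‖x‖ := by
  obtain ⟨K, _, _, _, J, U, hU, hk⟩ := hT
  have h := hk 1 le_rfl
  rw [pow_one, pow_one] at h
  rw [h, smul_apply, norm_smul, Complex.norm_real, Real.norm_of_nonneg hρ,
    ContinuousLinearMap.comp_apply, ContinuousLinearMap.comp_apply]
  gcongr
  have hJ : ‖ContinuousLinearMap.adjoint J.toContinuousLinearMap‖ ≤ 1 := by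
    rw [LinearIsometryEquiv.norm_map]
    exact J.norm_toContinuousLinearMap_le
  refine (ContinuousLinearMap.le_of_opNorm_le _ hJ _).trans ?_
  rw [one_mul]
  have hUn : ‖U (J x)‖ = ‖J x‖ := Unitary.norm_map ⟨U, hU⟩ (J x)
  exact (hUn.trans (J.norm_map x)).le

/-! ### The critical weight -/

section

variable {n : ℕ}

lemma isRhoContraction_truncatedShift_iff {ρ : ℝ} (hρ : 0 < ρ) (b : ℝ) :
    IsRhoContraction ρ (truncatedShift (n + 1) (b : ℂ)) ↔
      0 ≤ rhoKernel ρ n (truncatedShift (n + 1) (b : ℂ)) := by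
  refine ⟨fun h => rhoKernel_nonneg_of_toeplitzSum_nonneg (truncatedShift_pow_self _ _)
    fun N => ?_, isRhoContraction_of_rhoKernel_nonneg hρ⟩
  simpa using toeplitzSum_nonneg hρ.le h N (z := 1) (by simp)

lemma continuous_rhoKernel_truncatedShift (ρ : ℝ) :
    Continuous fun t : ℝ => rhoKernel ρ n (truncatedShift (n + 1) (t : ℂ)) := by
  simp only [fun t : ℝ => truncatedShift_eq_smul (n + 1) (t : ℂ)]
  unfold rhoKernel
  fun_prop

lemma isSelfAdjoint_rhoKernel {A : Type*} [Ring A] [StarRing A] [Algebra ℂ A] [StarModule ℂ A]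
    (ρ : ℝ) (T : A) : IsSelfAdjoint (rhoKernel ρ n T) := by
  unfold rhoKernel
  refine (IsSelfAdjoint.add_star_self _).add ?_
  rw [IsSelfAdjoint, star_smul, star_one]
  simp

/-- A self-adjoint perturbation of norm below `r` cannot destroy positivity of an operator bounded
below by `r`. -/
lemma eventually_rhoKernel_nonneg {ρ : ℝ} {t₀ r : ℝ} (hr : 0 < r)
    (h : algebraMap ℝ (EuclideanSpace ℂ (Fin (n + 1)) →L[ℂ] EuclideanSpace ℂ (Fin (n + 1))) r ≤
      rhoKernel ρ n (truncatedShift (n + 1) (t₀ : ℂ))) :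
    ∀ᶠ t : ℝ in nhds t₀, 0 ≤ rhoKernel ρ n (truncatedShift (n + 1) (t : ℂ)) := by
  have hc := (continuous_rhoKernel_truncatedShift (n := n) ρ).continuousAt (x := t₀)
  filter_upwards [Metric.tendsto_nhds.1 hc r hr] with t ht
  rw [dist_eq_norm] at ht
  set K := rhoKernel ρ n (truncatedShift (n + 1) (t : ℂ))
  set K₀ := rhoKernel ρ n (truncatedShift (n + 1) (t₀ : ℂ))
  have hsa : IsSelfAdjoint (K - K₀) :=
    (isSelfAdjoint_rhoKernel ρ _).sub (isSelfAdjoint_rhoKernel ρ _)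
  have h1 := hsa.neg_algebraMap_norm_le_self
  have h2 := algebraMap_mono (EuclideanSpace ℂ (Fin (n + 1)) →L[ℂ] EuclideanSpace ℂ (Fin (n + 1)))
    ht.le
  calc 0 ≤ algebraMap ℝ _ r - algebraMap ℝ _ ‖K - K₀‖ := sub_nonneg.2 h2
    _ ≤ K₀ + (K - K₀) := by rw [sub_eq_add_neg]; exact add_le_add h h1
    _ = K := by abel

lemma rhoRadius_truncatedShift_eq_sInf {ρ : ℝ} (hρ : 0 < ρ) :
    rhoRadius ρ (truncatedShift (n + 1) 1) =
      sInf {γ : ℝ | 0 < γ ∧ 0 ≤ rhoKernel ρ n (truncatedShift (n + 1) ((γ⁻¹ : ℝ) : ℂ))} := by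
  unfold rhoRadius rhoClass
  congr 1
  ext γ
  simp only [Set.mem_ofPred_eq]
  rw [← truncatedShift_eq_smul, isRhoContraction_truncatedShift_iff hρ, one_div]

/-- At the critical weight the kernel of the truncated shift is singular. -/
lemma rhoRadius_truncatedShift_pos_and_exists_null {ρ : ℝ} (hρ : 0 < ρ) (hn : 1 ≤ n) :
    0 < rhoRadius ρ (truncatedShift (n + 1) 1) ∧
      ∃ v, v ≠ 0 ∧ rhoKernel ρ n (normalizedShift ρ (n + 1)) v = 0 := by
  unfold normalizedShift
  rw [rhoRadius_truncatedShift_eq_sInf hρ]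
  set A := {γ : ℝ | 0 < γ ∧ 0 ≤ rhoKernel ρ n (truncatedShift (n + 1) ((γ⁻¹ : ℝ) : ℂ))} with hA
  -- At weight `0` the kernel is `ρ` times the identity, so it stays positive for small weights,
  -- that is, for large `γ`.
  have hne : A.Nonempty := by
    have h0 : algebraMap ℝ (EuclideanSpace ℂ (Fin (n + 1)) →L[ℂ] EuclideanSpace ℂ (Fin (n + 1))) ρ
        ≤ rhoKernel ρ n (truncatedShift (n + 1) ((0 : ℝ) : ℂ)) := by
      have hz : truncatedShift (n + 1) ((0 : ℝ) : ℂ) = 0 := by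
        ext x i
        simp [truncatedShift_apply]
      have hs : ∑ j ∈ Finset.range (n + 1), (0 : EuclideanSpace ℂ (Fin (n + 1)) →L[ℂ]
          EuclideanSpace ℂ (Fin (n + 1))) ^ j = 1 := by
        rw [Finset.sum_range_succ']
        simp
      refine le_of_eq ?_
      rw [hz, rhoKernel, hs, star_one, Algebra.algebraMap_eq_smul_one, ← Complex.coe_smul]
      module
    have hev := eventually_rhoKernel_nonneg hρ h0
    have hinv : Filter.Tendsto (fun γ : ℝ => γ⁻¹) Filter.atTop (nhds 0) := tendsto_inv_atTop_zero
    obtain ⟨γ, h1, h2⟩ := ((hinv.eventually hev).and (Filter.eventually_gt_atTop 0)).exists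
    exact ⟨γ, h2, h1⟩
  -- A `ρ`-contraction has norm at most `ρ`, while the shift of weight `γ⁻¹` sends `e_1` to `γ⁻¹
  -- e_0`.
  have hlow : ∀ γ ∈ A, ρ⁻¹ ≤ γ := by
    rintro γ ⟨hγ, hK⟩
    have h1 := ((isRhoContraction_truncatedShift_iff hρ _).2 hK).norm_apply_le hρ.le
      (EuclideanSpace.single (⟨1, by omega⟩ : Fin (n + 1)) 1)
    have h2 := PiLp.norm_apply_le (truncatedShift (n + 1) ((γ⁻¹ : ℝ) : ℂ)
      (EuclideanSpace.single (⟨1, by omega⟩ : Fin (n + 1)) 1)) (0 : Fin (n + 1))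
    rw [truncatedShift_apply, dif_pos (by simp; omega)] at h2
    simp only [Fin.val_zero, zero_add, PiLp.single_apply, if_true, mul_one, Complex.norm_real,
      norm_inv, Real.norm_of_nonneg hγ.le] at h2
    rw [PiLp.norm_single, norm_one, mul_one] at h1
    rw [inv_le_comm₀ hρ hγ]
    exact h2.trans h1
  have hbdd : BddBelow A := ⟨ρ⁻¹, hlow⟩
  set γ₀ := sInf A with hγ₀
  have hpos : 0 < γ₀ := (inv_pos.2 hρ).trans_le (le_csInf hne hlow)
  refine ⟨hpos, ?_⟩
  have hcont : ContinuousAt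
      (fun γ : ℝ => rhoKernel ρ n (truncatedShift (n + 1) ((γ⁻¹ : ℝ) : ℂ))) γ₀ :=
    (continuous_rhoKernel_truncatedShift ρ).continuousAt.comp (continuousAt_inv₀ hpos.ne')
  have hnonneg : 0 ≤ rhoKernel ρ n (truncatedShift (n + 1) ((γ₀⁻¹ : ℝ) : ℂ)) := by
    obtain ⟨u, -, hu, huA⟩ := exists_seq_tendsto_sInf hne hbdd
    exact ge_of_tendsto' (hcont.tendsto.comp hu) fun k => (huA k).2
  by_contra! hnull
  set K := rhoKernel ρ n (truncatedShift (n + 1) ((γ₀⁻¹ : ℝ) : ℂ)) with hK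
  -- In finite dimension an injective positive kernel is bounded below by some `r > 0`, so it stays
  -- positive for some `γ < γ₀`, against minimality.
  have hinj : Function.Injective K := by
    refine (injective_iff_map_eq_zero K).2 fun v hv => ?_
    by_contra hv0
    exact hnull v hv0 hv
  have hsurj : Function.Surjective K.toLinearMap := LinearMap.injective_iff_surjective.1 hinj
  have hunit : IsUnit K := ContinuousLinearMap.isUnit_iff_bijective.2 ⟨hinj, hsurj⟩
  have hsp : IsStrictlyPositive K := IsStrictlyPositive.iff_of_unital.2 ⟨hnonneg, hunit⟩
  obtain ⟨r, hr, hrK⟩ := (CFC.exists_pos_algebraMap_le_iff hsp.isSelfAdjoint).2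
    fun x hx => hsp.spectrum_pos hx
  have hev := (continuousAt_inv₀ hpos.ne').tendsto.eventually (eventually_rhoKernel_nonneg hr hrK)
  obtain ⟨l, hl, hlA⟩ := exists_Ioc_subset_of_mem_nhds hev ⟨0, hpos⟩
  -- The first entry keeps the point above `l`, the second keeps it positive.
  have hm : max ((l + γ₀) / 2) (γ₀ / 2) < γ₀ := max_lt (by linarith) (by linarith)
  have hmem : max ((l + γ₀) / 2) (γ₀ / 2) ∈ A := by
    refine ⟨lt_max_of_lt_right (by linarith), hlA ⟨lt_max_of_lt_left (by linarith), hm.le⟩⟩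
  exact absurd (csInf_le hbdd hmem) (not_le.2 hm)

end

end

/-! ### Reading off the coefficient relations -/

theorem proposition3p5 (n : ℕ) (hn : 1 ≤ n) (ρ : ℝ) (hρ : 1 < ρ)
    (T : EuclideanSpace ℂ (Fin (n + 1)) →L[ℂ] EuclideanSpace ℂ (Fin (n + 1)))
    (hT : T ∈ rhoClass ρ (EuclideanSpace ℂ (Fin (n + 1))))
    (hTS : HarnackEquivalent ρ T (normalizedShift ρ (n + 1))) :
    T (EuclideanSpace.single 0 1) = 0 ∧
      ContinuousLinearMap.adjoint T (EuclideanSpace.single (Fin.last n) 1) = 0 ∧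
      (2 ≤ n →
        inner ℂ (T (EuclideanSpace.single (Fin.last n) 1)) (EuclideanSpace.single 0 1) = 0) := by
  have hρ0 : 0 < ρ := by linarith
  have hρ1 : (ρ : ℂ) - 1 ≠ 0 := sub_ne_zero.2 (by exact_mod_cast hρ.ne')
  obtain ⟨hpos, v, hv0, hv⟩ := rhoRadius_truncatedShift_pos_and_exists_null hρ0 hn
  have ha : (((rhoRadius ρ (truncatedShift (n + 1) 1))⁻¹ : ℝ) : ℂ) ≠ 0 :=
    Complex.ofReal_ne_zero.2 (inv_ne_zero hpos.ne')
  have hfirst : v 0 ≠ 0 := fun h =>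
    hv0 (eq_zero_of_rhoKernel_apply_eq_zero_of_zero hρ.ne' ha hv h)
  have hlast : v (Fin.last n) ≠ 0 := fun h =>
    hv0 (eq_zero_of_rhoKernel_apply_eq_zero_of_last hρ.ne' ha hv h)
  obtain ⟨u, hu⟩ : ∃ u : Fin (n + 1) → EuclideanSpace ℂ (Fin (n + 1)),
      ∀ k, u k = v k • EuclideanSpace.single k (1 : ℂ) := ⟨_, fun _ => rfl⟩
  have hsum := hTS.1.sum_symbolCoeff_eq_zero hρ0.le hT (truncatedShift_pow_self _ _) u
    fun z hz => by simpa only [hu, normalizedShift] using rhoKernel_smul_truncatedShift_apply hv hz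
  have hT0 : T (u 0) = 0 := by
    have h0 := hsum 0
    have h1 := hsum 1
    rw [Fin.sum_univ_succ] at h0 h1
    have e0 : ∀ k : Fin n, symbolCoeff ρ T (0 + (k.succ : Fin (n + 1))) = T ^ ((k : ℕ) + 1) := by
      intro k
      rw [zero_add, symbolCoeff_natCast _ _ (by simp), Fin.val_succ]
    have e1 : ∀ k : Fin n, symbolCoeff ρ T (1 + (k.succ : Fin (n + 1))) =
        T * T ^ ((k : ℕ) + 1) := by
      intro k
      rw [← pow_succ', ← symbolCoeff_natCast ρ T (by omega), Fin.val_succ]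
      congr 1
      push_cast
      ring
    have e2 : symbolCoeff ρ T (1 + ((0 : Fin (n + 1)) : ℕ)) = T := by
      have := symbolCoeff_natCast ρ T one_ne_zero
      rw [pow_one] at this
      simpa using this
    have e3 : symbolCoeff ρ T (0 + ((0 : Fin (n + 1)) : ℕ)) = (ρ : ℂ) • 1 := symbolCoeff_zero ρ T
    simp only [e0, e3, smul_apply, one_apply_eq_self] at h0
    simp only [e1, e2, mul_apply_eq_comp] at h1
    -- The tail of the relation `m = 1` is `T` applied to the tail of `m = 0`, which equals `-ρ u
    -- 0`.
    rw [← map_sum, eq_neg_of_add_eq_zero_right h0, map_neg, map_smul] at h1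
    have h2 : ((ρ : ℂ) - 1) • T (u 0) = 0 := by
      rw [sub_smul, one_smul, ← neg_eq_zero, ← h1]
      abel
    exact (smul_eq_zero.1 h2).resolve_left hρ1
  have hTn : star T (u (Fin.last n)) = 0 := by
    have h0 := hsum (-n)
    have h1 := hsum (-n - 1)
    rw [Fin.sum_univ_castSucc] at h0 h1
    have e0 : ∀ k : Fin n, symbolCoeff ρ T (-n + (k.castSucc : Fin (n + 1))) =
        star T ^ (n - k) := by
      intro k
      rw [← symbolCoeff_neg_natCast ρ T (by omega), Fin.val_castSucc]
      congr 1
      omega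
    have e1 : ∀ k : Fin n, symbolCoeff ρ T (-n - 1 + (k.castSucc : Fin (n + 1))) =
        star T * star T ^ (n - k) := by
      intro k
      rw [← pow_succ', ← symbolCoeff_neg_natCast ρ T (by omega), Fin.val_castSucc]
      congr 1
      omega
    have e2 : symbolCoeff ρ T (-n - 1 + (Fin.last n : ℕ)) = star T := by
      have := symbolCoeff_neg_natCast ρ T one_ne_zero
      rw [pow_one] at this
      rw [← this, Fin.val_last]
      congr 1
      omega
    have e3 : symbolCoeff ρ T (-n + (Fin.last n : ℕ)) = (ρ : ℂ) • 1 := by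
      rw [Fin.val_last, neg_add_cancel, symbolCoeff_zero]
    simp only [e0, e3, smul_apply, one_apply_eq_self] at h0
    simp only [e1, e2, mul_apply_eq_comp] at h1
    rw [← map_sum, eq_neg_of_add_eq_zero_left h0, map_neg, map_smul] at h1
    have h2 : ((ρ : ℂ) - 1) • star T (u (Fin.last n)) = 0 := by
      rw [sub_smul, one_smul, ← neg_eq_zero, ← h1]
      abel
    exact (smul_eq_zero.1 h2).resolve_left hρ1
  have hTe : T (EuclideanSpace.single 0 1) = 0 := by
    rw [hu, map_smul] at hT0
    exact (smul_eq_zero.1 hT0).resolve_left hfirst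
  refine ⟨hTe, ?_, fun h2n => ?_⟩
  · rw [hu, map_smul] at hTn
    exact (smul_eq_zero.1 hTn).resolve_left hlast
  · have h := hsum (-n + 1)
    rw [Fin.sum_univ_castSucc] at h
    have e2 : symbolCoeff ρ T (-n + 1 + (Fin.last n : ℕ)) = T := by
      have := symbolCoeff_natCast ρ T one_ne_zero
      rw [pow_one] at this
      rw [← this, Fin.val_last]
      congr 1
      omega
    -- For `k = n - 1` the coefficient is `ρ`, and `e_{n-1}` is orthogonal to `e_0` because `n ≥ 2`.
    -- For smaller `k` it is a positive power of `T*`, which moves onto `e_0` and vanishes as `T e_0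
    -- = 0`.
    have hk : ∀ k : Fin n, inner ℂ (symbolCoeff ρ T (-n + 1 + (k.castSucc : Fin (n + 1)))
        (u k.castSucc)) (EuclideanSpace.single (0 : Fin (n + 1)) (1 : ℂ)) = 0 := by
      intro k
      rw [Fin.val_castSucc]
      by_cases hkn : (k : ℕ) + 1 = n
      · have : (-n + 1 + (k : ℕ) : ℤ) = 0 := by omega
        rw [this, symbolCoeff_zero, smul_apply, one_apply_eq_self, hu, inner_smul_left,
          inner_smul_left, EuclideanSpace.inner_single_left, PiLp.single_apply,
          if_neg fun h' => ?_]
        · simp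
        · have := congrArg Fin.val h'
          simp at this
          omega
      · have : (-n + 1 + (k : ℕ) : ℤ) = -((n - 1 - k : ℕ) : ℤ) := by omega
        rw [this, symbolCoeff_neg_natCast _ _ (by omega), ← star_pow,
          ContinuousLinearMap.star_eq_adjoint, ContinuousLinearMap.adjoint_inner_left]
        obtain ⟨j, hj⟩ : ∃ j, n - 1 - (k : ℕ) = j + 1 := ⟨n - 2 - k, by omega⟩
        rw [hj, pow_succ, mul_apply_eq_comp, hTe, map_zero, inner_zero_right]
    have h3 := congrArg (fun w => inner ℂ w (EuclideanSpace.single (0 : Fin (n + 1)) (1 : ℂ))) h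
    simp only [inner_add_left, sum_inner, hk, Finset.sum_const_zero, zero_add, e2,
      inner_zero_left] at h3
    rw [hu, map_smul, inner_smul_left, mul_eq_zero] at h3
    exact h3.resolve_left (by simpa using hlast)
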